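/- All graphs are finite and simple. The stability number $\alpha(G)$ of a graph $G$ is the maximum size of a stable set of $G$, that is, of a set of pairwise non-adjacent vertices; a stable set of size $\alpha(G)$ is called a stability system of $G$. $G$ is called $\alpha$-stable if $\alpha(G-e)=\alpha(G)$ for every edge $e$ of $G$ and $\alpha(G+e)=\alpha(G)$ for every edge $e$ of the complement of $G$. A bipartite graph with colour classes $A,B$ is called bistable if it has exactly two stability systems, namely $A$ and $B$. A perfect matching of $G$ is a set of pairwise non-incident edges covering all vertices, and a cycle of $G$ is called alternating if, for some perfect matching $M$ of $G$, its edges are alternately in $M$ and not in $M$. Theorem 5.6. Let $G$ be a connected bipartite graph with at least two vertices. Then the following assertions are equivalent: (i) $G$ is $\alpha$-stable; (ii) for some $k\ge 1$, the vertex set of $G$ can be partitioned into sets $V_1,\dots,V_k$ such that each induced subgraph $G_i=G[V_i]$, $1\le i\le k$, is bistable bipartite and has at least $4$ vertices; (iii) $G$ has a perfect matching, and the intersection of all perfect matchings of $G$ (as sets of edges) is empty; (iv) every vertex of $G$ is incident to at least two edges each of which is contained in some perfect matching of $G$; (v) every vertex of $G$ belongs to some alternating cycle of $G$. -/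

import Mathlib

namespace AlphaStable

variable {V : Type*}

/-- Deleting any edge of `G` leaves the stability number unchanged. -/
def IsAlphaMinusStable (G : SimpleGraph V) : Prop :=
  ∀ e ∈ G.edgeSet, (G.deleteEdges {e}).indepNum = G.indepNum

/-- Adding any edge of the complement of `G` leaves the stability number unchanged. -/
def IsAlphaPlusStable (G : SimpleGraph V) : Prop :=
  ∀ e ∈ Gᶜ.edgeSet, (G ⊔ SimpleGraph.fromEdgeSet {e}).indepNum = G.indepNum

/-- `G` is `α`-stable: both `α⁻`-stable and `α⁺`-stable. -/
def IsAlphaStable (G : SimpleGraph V) : Prop :=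
  IsAlphaMinusStable G ∧ IsAlphaPlusStable G

/-- `G` is bistable bipartite: it has a bipartition into colour classes `A`, `B`, and it has exactly
two stability systems (stable sets of maximum size), namely `A` and `B`. -/
def IsBistableBipartite [Finite V] (G : SimpleGraph V) : Prop :=
  ∃ A B : Finset V,
    G.IsBipartiteWith (A : Set V) (B : Set V) ∧ (A : Set V) ∪ (B : Set V) = Set.univ ∧
    A ≠ B ∧ ∀ S : Finset V, G.IsMaximumIndepSet S ↔ S = A ∨ S = B

/-- The vertex set of `G` is partitioned into `k ≥ 1` sets, each of which spans a bistable
bipartite subgraph on at least four vertices. -/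
def HasBistableDecomposition [Finite V] (G : SimpleGraph V) : Prop :=
  ∃ (k : ℕ) (U : Fin k → Set V), 1 ≤ k ∧
    Pairwise (fun i j => Disjoint (U i) (U j)) ∧ (⋃ i, U i) = Set.univ ∧
    ∀ i, IsBistableBipartite (G.induce (U i)) ∧ 4 ≤ (U i).ncard

/-- The closed walk `p` is an alternating cycle: a cycle for which some perfect matching `M` of `G`
contains exactly one of any two consecutive edges. (At each vertex of a cycle there are exactly two
edges of the cycle, and `SimpleGraph.IsAlternating` says that exactly one of them is in `M`.) -/
def IsAlternatingCycle (G : SimpleGraph V) {u : V} (p : G.Walk u u) : Prop :=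
  p.IsCycle ∧ ∃ M : G.Subgraph, M.IsPerfectMatching ∧
    p.toSubgraph.spanningCoe.IsAlternating M.spanningCoe

end AlphaStable

/-!
Everything reduces to one property: no edge of `G` lies in all perfect matchings of `G`.

If `G` is bipartite with classes `A` and `B` and `S`, `T` are stability systems, then so is
`(S ∩ T ∩ A) ∪ ((S ∪ T) ∩ B)`. A stability system with as few vertices in `A` as possible therefore
meets `A` only in vertices common to all stability systems. An `α`-stable graph has at most one such
vertex, since the edge joining two of them would lower the stability number; hence both colour
classes are stability systems. They remain so when an edge is deleted, and Hall's theorem gives a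
perfect matching avoiding that edge. Conversely, a perfect matching pins `2α` to the number of
vertices.

Two perfect matchings differ in alternating cycles, and switching along an alternating cycle
changes the edge matched to each of its vertices. Finally, in a bipartite graph with a perfect
matching a stability system contains exactly one end of every edge of every perfect matching, so it
is determined on each component of the graph of all such edges by a single vertex: these components
are the bistable parts.
-/

namespace AlphaStable

open Finset SimpleGraph
open scoped symmDiff

section StableSets

variable {V : Type*} {G H : SimpleGraph V} {x y : V}

lemma isIndepSet_mono (hle : G ≤ H) {S : Set V} (hS : H.IsIndepSet S) : G.IsIndepSet S :=
  hS.mono' fun _ _ hnadj hadj => hnadj (hle hadj)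

lemma isIndepSet_sup_fromEdgeSet {S : Set V} (hS : G.IsIndepSet S) (hxy : x ∈ S → y ∉ S) :
    (G ⊔ fromEdgeSet {s(x, y)}).IsIndepSet S := by
  rintro v hv w hw hne (hvw | hvw)
  · exact hS hv hw hne hvw
  · rcases Sym2.eq_iff.1 (Set.mem_singleton_iff.1 hvw.1) with ⟨rfl, rfl⟩ | ⟨rfl, rfl⟩
    · exact hxy hv hw
    · exact hxy hw hv

lemma isIndepSet_of_deleteEdges {S : Set V} (hS : (G.deleteEdges {s(x, y)}).IsIndepSet S)
    (hxy : x ∈ S → y ∉ S) : G.IsIndepSet S := by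
  refine isIndepSet_mono (fun v w hvw => ?_) (isIndepSet_sup_fromEdgeSet hS hxy)
  simp only [sup_adj, deleteEdges_adj, fromEdgeSet_adj, hvw, hvw.ne, ne_eq, not_false_eq_true,
    true_and, and_true]
  exact (em _).symm

variable [Finite V]

lemma indepNum_anti : Antitone (indepNum : SimpleGraph V → ℕ) := by
  intro G H hle
  obtain ⟨S, hS⟩ := H.exists_isNIndepSet_indepNum
  exact hS.card_eq ▸ (isIndepSet_mono hle hS.isIndepSet).card_le_indepNum

lemma isMaximumIndepSet_iff_card_eq {S : Finset V} :
    G.IsMaximumIndepSet S ↔ G.IsIndepSet (S : Set V) ∧ #S = G.indepNum :=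
  ⟨fun hS => ⟨hS.isIndepSet, G.maximumIndepSet_card_eq_indepNum S hS⟩,
    fun ⟨hS, hcard⟩ => ⟨hS, fun _ hT => hT.card_le_indepNum.trans_eq hcard.symm⟩⟩

lemma mem_of_indepNum_lt_card {S : Finset V}
    (hS : (G.deleteEdges {s(x, y)}).IsIndepSet (S : Set V)) (hcard : G.indepNum < #S) :
    x ∈ S ∧ y ∈ S := by
  by_contra hxy
  exact hcard.not_ge (isIndepSet_of_deleteEdges hS (not_and.1 hxy)).card_le_indepNum

lemma isMaximumIndepSet_erase_of_deleteEdges [DecidableEq V] {S : Finset V}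
    (hS : (G.deleteEdges {s(x, y)}).IsIndepSet (S : Set V)) (hcard : G.indepNum < #S) :
    G.IsMaximumIndepSet (S.erase x) ∧ G.IsMaximumIndepSet (S.erase y) := by
  have herase {z : V} (hz : z ∈ S) (hxy : x ∈ S.erase z → y ∉ S.erase z) :
      G.IsMaximumIndepSet (S.erase z) := by
    have hindep : G.IsIndepSet (S.erase z : Set V) :=
      isIndepSet_of_deleteEdges (hS.mono (coe_subset.2 (erase_subset z S))) hxy
    have hle := hindep.card_le_indepNum
    have hcard_erase := card_erase_add_one hz
    exact isMaximumIndepSet_iff_card_eq.2 ⟨hindep, by omega⟩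
  obtain ⟨hx, hy⟩ := mem_of_indepNum_lt_card hS hcard
  exact ⟨herase hx fun hmem => absurd hmem (notMem_erase x S), herase hy fun _ => notMem_erase y S⟩

/-- The core of `G`: the vertices common to all stability systems of `G`. -/
def core (G : SimpleGraph V) : Set V :=
  {v | ∀ S : Finset V, G.IsMaximumIndepSet S → v ∈ S}

lemma IsAlphaPlusStable.core_subsingleton (h : IsAlphaPlusStable G) :
    (core G).Subsingleton := by
  intro x hx y hy
  by_contra hne
  obtain ⟨S, hS⟩ := G.maximumIndepSet_exists
  have hxy : ¬ G.Adj x y := hS.isIndepSet (hx S hS) (hy S hS) hne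
  have hnum := h s(x, y) (by simpa [hne] using hxy)
  obtain ⟨T, hT⟩ := (G ⊔ fromEdgeSet {s(x, y)}).exists_isNIndepSet_indepNum
  have hTmax : G.IsMaximumIndepSet T :=
    isMaximumIndepSet_iff_card_eq.2
      ⟨isIndepSet_mono le_sup_left hT.isIndepSet, hT.card_eq.trans hnum⟩
  exact hT.isIndepSet (hx T hTmax) (hy T hTmax) hne (by simp [hne])

end StableSets

/-- `A` and `B` are the colour classes of a bipartition of the whole vertex set of `G`. They are
finsets because Mathlib's maximum independent sets are. -/
structure IsBipartition {V : Type*} (G : SimpleGraph V) (A B : Finset V) : Prop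
    extends G.IsBipartiteWith (A : Set V) (B : Set V) where
  union_eq_univ : (A : Set V) ∪ (B : Set V) = Set.univ

lemma exists_isBipartition {V : Type*} [Finite V] {G : SimpleGraph V} (hG : G.IsBipartite) :
    ∃ A B, IsBipartition G A B := by
  classical
  have := Fintype.ofFinite V
  obtain ⟨c⟩ := hG
  refine ⟨univ.filter (c · = 0), univ.filter (c · ≠ 0), ⟨?_, fun v w hvw => ?_⟩, ?_⟩
  · exact disjoint_coe.2 (disjoint_filter_filter_not _ _ _)
  · have := c.valid hvw
    simp only [coe_filter, mem_univ, true_and, Set.mem_ofPred_eq]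
    omega
  · ext v
    simpa using em _

namespace IsBipartition

variable {V : Type*} {G H : SimpleGraph V} {A B S T : Finset V} {v w : V}

lemma symm (h : IsBipartition G A B) : IsBipartition G B A :=
  ⟨h.toIsBipartiteWith.symm, by rw [Set.union_comm, h.union_eq_univ]⟩

lemma mono (h : IsBipartition G A B) (hle : H ≤ G) : IsBipartition H A B :=
  ⟨⟨h.disjoint, fun _ _ hvw => h.mem_of_adj (hle hvw)⟩, h.union_eq_univ⟩

lemma disjoint_finset (h : IsBipartition G A B) : Disjoint A B :=
  disjoint_coe.1 h.disjoint

lemma mem_or_mem (h : IsBipartition G A B) (v : V) : v ∈ A ∨ v ∈ B := by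
  have hv : v ∈ (A : Set V) ∪ B := h.union_eq_univ ▸ Set.mem_univ v
  simpa using hv

lemma mem_right_iff (h : IsBipartition G A B) : v ∈ B ↔ v ∉ A :=
  ⟨fun hB hA => disjoint_left.1 h.disjoint_finset hA hB, (h.mem_or_mem v).resolve_left⟩

lemma mem_left_iff_of_adj (h : IsBipartition G A B) (hvw : G.Adj v w) : v ∈ A ↔ w ∉ A := by
  have hmem := h.mem_of_adj hvw
  simp only [mem_coe, h.mem_right_iff] at hmem
  tauto

lemma isIndepSet_left (h : IsBipartition G A B) : G.IsIndepSet (A : Set V) :=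
  fun _ hv _ hw _ hvw => (h.mem_left_iff_of_adj hvw).1 hv hw

lemma card_inter_add_card_inter [DecidableEq V] (h : IsBipartition G A B) (S : Finset V) :
    #(S ∩ A) + #(S ∩ B) = #S := by
  have hsdiff : S ∩ B = S \ A := by
    ext v
    simp [h.mem_right_iff]
  rw [hsdiff, card_inter_add_card_sdiff]

lemma card_add_card [Finite V] (h : IsBipartition G A B) : #A + #B = Nat.card V := by
  rw [← Set.ncard_univ, ← h.union_eq_univ, Set.ncard_union_eq h.disjoint, Set.ncard_coe_finset,
    Set.ncard_coe_finset]

lemma isIndepSet_inter_union [DecidableEq V] (h : IsBipartition G A B)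
    (hS : G.IsIndepSet (S : Set V)) (hT : G.IsIndepSet (T : Set V)) :
    G.IsIndepSet (((S ∩ T ∩ A) ∪ ((S ∪ T) ∩ B) : Finset V) : Set V) := by
  intro v hv w hw hne hvw
  have hside := h.mem_left_iff_of_adj hvw
  have hnotS : ¬ (v ∈ S ∧ w ∈ S) := fun hmem => hS hmem.1 hmem.2 hne hvw
  have hnotT : ¬ (v ∈ T ∧ w ∈ T) := fun hmem => hT hmem.1 hmem.2 hne hvw
  simp only [mem_coe, mem_union, mem_inter, h.mem_right_iff] at hv hw
  tauto

variable [Finite V]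

-- The two mixed sets have sizes adding up to `#S + #T`, so neither can fall short of the maximum.
lemma isMaximumIndepSet_inter_union [DecidableEq V] (h : IsBipartition G A B)
    (hS : G.IsMaximumIndepSet S) (hT : G.IsMaximumIndepSet T) :
    G.IsMaximumIndepSet ((S ∩ T ∩ A) ∪ ((S ∪ T) ∩ B)) := by
  refine ⟨h.isIndepSet_inter_union hS.isIndepSet hT.isIndepSet,
    fun R hR => (hS.maximum R hR).trans ?_⟩
  have hdual := hT.maximum _ (h.symm.isIndepSet_inter_union hS.isIndepSet hT.isIndepSet)
  have hAB : Disjoint (S ∩ T ∩ A) ((S ∪ T) ∩ B) :=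
    h.disjoint_finset.mono inter_subset_right inter_subset_right
  have hBA : Disjoint (S ∩ T ∩ B) ((S ∪ T) ∩ A) :=
    h.symm.disjoint_finset.mono inter_subset_right inter_subset_right
  rw [card_union_of_disjoint hBA] at hdual
  rw [card_union_of_disjoint hAB]
  have hinter := h.card_inter_add_card_inter (S ∩ T)
  have hunion := h.card_inter_add_card_inter (S ∪ T)
  have hsum := card_union_add_card_inter S T
  omega

-- Among all stability systems, take one that meets `A` in as few vertices as possible.
lemma exists_isMaximumIndepSet_inter_subset_core (h : IsBipartition G A B) :
    ∃ S : Finset V, G.IsMaximumIndepSet S ∧ (S ∩ A : Set V) ⊆ core G := by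
  classical
  have hne : {S : Finset V | G.IsMaximumIndepSet S}.Nonempty := G.maximumIndepSet_exists
  obtain ⟨S, hS, hmin⟩ := Set.exists_min_image _ (fun S => #(S ∩ A)) (Set.toFinite _) hne
  refine ⟨S, hS, fun x hx T hT => ?_⟩
  have hinter : ((S ∩ T ∩ A) ∪ ((S ∪ T) ∩ B)) ∩ A = S ∩ T ∩ A := by
    ext v
    simp only [mem_inter, mem_union, h.mem_right_iff]
    tauto
  have hle : #(S ∩ A) ≤ #(S ∩ T ∩ A) := hinter ▸ hmin _ (h.isMaximumIndepSet_inter_union hS hT)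
  have heq : S ∩ T ∩ A = S ∩ A :=
    eq_of_subset_of_card_le (inter_subset_inter_right inter_subset_left) hle
  have hxSTA : x ∈ S ∩ T ∩ A := heq ▸ mem_inter.2 hx
  exact (mem_inter.1 (mem_inter.1 hxSTA).1).2

lemma isMaximumIndepSet_right_of_subsingleton_core (h : IsBipartition G A B)
    (hcore : (core G).Subsingleton) (hnbr : ∀ v, ∃ w, G.Adj v w) : G.IsMaximumIndepSet B := by
  classical
  obtain ⟨S, hS, hSA⟩ := h.exists_isMaximumIndepSet_inter_subset_core
  refine ⟨h.symm.isIndepSet_left, fun R hR => (hS.maximum R hR).trans ?_⟩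
  by_cases hmeet : ∃ x ∈ S, x ∈ A
  · -- `x` is the only vertex of `S ∩ A`, and `S` misses some neighbour `w ∈ B` of `x`.
    obtain ⟨x, hxS, hxA⟩ := hmeet
    obtain ⟨w, hxw⟩ := hnbr x
    have hwB : w ∈ B := h.mem_right_iff.2 ((h.mem_left_iff_of_adj hxw).1 hxA)
    have hwS : w ∉ S := fun hwS => hS.isIndepSet hxS hwS hxw.ne hxw
    have hsub : S ⊆ insert x (B.erase w) := by
      intro v hv
      rw [mem_insert, mem_erase]
      rcases h.mem_or_mem v with hvA | hvB
      · exact .inl (hcore (hSA ⟨hv, hvA⟩) (hSA ⟨hxS, hxA⟩))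
      · exact .inr ⟨fun hvw => hwS (hvw ▸ hv), hvB⟩
    calc #S ≤ #(insert x (B.erase w)) := card_le_card hsub
      _ ≤ #(B.erase w) + 1 := card_insert_le _ _
      _ = #B := card_erase_add_one hwB
  · push Not at hmeet
    exact card_le_card fun v hv => (h.mem_or_mem v).resolve_left (hmeet v hv)

end IsBipartition

section Matchings

variable {V : Type*} {G : SimpleGraph V} {M : G.Subgraph}

lemma ncard_biUnion_neighborSet (hM : M.IsMatching) {S : Set V} (hSM : S ⊆ M.verts) :
    (⋃ v ∈ S, M.neighborSet v).ncard = S.ncard := by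
  choose! partner hpartner using fun v (hv : v ∈ S) => (hM (hSM hv)).exists
  have himage : ⋃ v ∈ S, M.neighborSet v = partner '' S := by
    ext w
    simp only [Set.mem_iUnion, Subgraph.mem_neighborSet, exists_prop, Set.mem_image]
    refine exists_congr fun v => and_congr_right fun hv => ?_
    exact ⟨hM.eq_of_adj_left (hpartner v hv), fun hvw => hvw ▸ hpartner v hv⟩
  rw [himage]
  exact Set.InjOn.ncard_image fun v hv w hw hvw =>
    hM.eq_of_adj_right (hpartner v hv) (hvw ▸ hpartner w hw)

lemma union_biUnion_neighborSet_subset_verts {S : Set V} (hSM : S ⊆ M.verts) :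
    S ∪ ⋃ v ∈ S, M.neighborSet v ⊆ M.verts :=
  Set.union_subset hSM (Set.iUnion₂_subset fun _ _ _ hvw => M.edge_vert hvw.symm)

variable [Finite V]

lemma ncard_union_biUnion_neighborSet (hM : M.IsMatching) {S : Set V} (hS : G.IsIndepSet S)
    (hSM : S ⊆ M.verts) : (S ∪ ⋃ v ∈ S, M.neighborSet v).ncard = 2 * S.ncard := by
  have hdisj : Disjoint S (⋃ v ∈ S, M.neighborSet v) := by
    simp only [Set.disjoint_right, Set.mem_iUnion, exists_prop]
    rintro w ⟨v, hv, hvw⟩ hw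
    exact hS hv hw hvw.ne hvw.adj_sub
  rw [Set.ncard_union_eq hdisj, ncard_biUnion_neighborSet hM hSM, two_mul]

lemma two_mul_ncard_le_ncard_verts (hM : M.IsMatching) {S : Set V} (hS : G.IsIndepSet S)
    (hSM : S ⊆ M.verts) : 2 * S.ncard ≤ M.verts.ncard :=
  ncard_union_biUnion_neighborSet hM hS hSM ▸
    Set.ncard_le_ncard (union_biUnion_neighborSet_subset_verts hSM)

lemma mem_iff_notMem_of_two_mul_ncard_eq (hM : M.IsMatching) {S : Set V} (hS : G.IsIndepSet S)
    (hSM : S ⊆ M.verts) (hcard : 2 * S.ncard = M.verts.ncard) {v w : V} (hvw : M.Adj v w) :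
    v ∈ S ↔ w ∉ S := by
  refine ⟨fun hv hw => hS hv hw hvw.ne hvw.adj_sub, fun hw => ?_⟩
  have heq : S ∪ ⋃ v ∈ S, M.neighborSet v = M.verts :=
    Set.eq_of_subset_of_ncard_le (union_biUnion_neighborSet_subset_verts hSM)
      (by rw [ncard_union_biUnion_neighborSet hM hS hSM, hcard])
  have hwmem : w ∈ ⋃ v ∈ S, M.neighborSet v :=
    (heq.symm.subset (M.edge_vert hvw.symm)).resolve_left hw
  simp only [Set.mem_iUnion, exists_prop] at hwmem
  obtain ⟨u, hu, huw⟩ := hwmem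
  exact hM.eq_of_adj_right huw hvw ▸ hu

lemma two_mul_card_le (hM : M.IsPerfectMatching) {S : Finset V}
    (hS : G.IsIndepSet (S : Set V)) : 2 * #S ≤ Nat.card V := by
  simpa [hM.2.verts_eq_univ] using
    two_mul_ncard_le_ncard_verts hM.1 hS (by simp [hM.2.verts_eq_univ])

namespace IsBipartition

variable {A B : Finset V}

lemma two_mul_card_left (h : IsBipartition G A B) (hM : M.IsPerfectMatching) :
    2 * #A = Nat.card V := by
  have hA := two_mul_card_le hM h.isIndepSet_left
  have hB := two_mul_card_le hM h.symm.isIndepSet_left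
  have hsum := h.card_add_card
  omega

lemma two_mul_indepNum (h : IsBipartition G A B) (hM : M.IsPerfectMatching) :
    2 * G.indepNum = Nat.card V := by
  obtain ⟨S, hS⟩ := G.exists_isNIndepSet_indepNum
  have hle := hS.card_eq ▸ two_mul_card_le hM hS.isIndepSet
  have hA := h.isIndepSet_left.card_le_indepNum
  have hcard := h.two_mul_card_left hM
  omega

lemma isMaximumIndepSet_iff (h : IsBipartition G A B) (hM : M.IsPerfectMatching) {S : Finset V} :
    G.IsMaximumIndepSet S ↔ G.IsIndepSet (S : Set V) ∧ 2 * #S = Nat.card V := by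
  rw [isMaximumIndepSet_iff_card_eq, ← h.two_mul_indepNum hM, Nat.mul_right_inj two_ne_zero]

lemma isMaximumIndepSet_left (h : IsBipartition G A B) (hM : M.IsPerfectMatching) :
    G.IsMaximumIndepSet A :=
  (h.isMaximumIndepSet_iff hM).2 ⟨h.isIndepSet_left, h.two_mul_card_left hM⟩

-- `X ∪ (B \ N(X))` is stable, hence no larger than `B`.
lemma ncard_le_ncard_biUnion_neighborSet (h : IsBipartition G A B) (hB : G.IsMaximumIndepSet B)
    {X : Set V} (hX : X ⊆ A) : X.ncard ≤ (⋃ x ∈ X, G.neighborSet x).ncard := by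
  set N := ⋃ x ∈ X, G.neighborSet x
  have hNB : N ⊆ B :=
    Set.iUnion₂_subset fun x hx => isBipartiteWith_neighborSet_subset h.toIsBipartiteWith (hX hx)
  have hindep : G.IsIndepSet (X ∪ (B \ N)) := by
    have hnot : ∀ x ∈ X, ∀ w ∈ X ∪ (B \ N), ¬ G.Adj x w := by
      rintro x hx w (hw | hw) hxw
      · exact h.isIndepSet_left (hX hx) (hX hw) hxw.ne hxw
      · exact hw.2 (Set.mem_biUnion hx hxw)
    rintro v (hv | hv) w (hw | hw) hne hvw
    · exact hnot v hv w (.inl hw) hvw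
    · exact hnot v hv w (.inr hw) hvw
    · exact hnot w hw v (.inr hv) hvw.symm
    · exact h.symm.isIndepSet_left hv.1 hw.1 hne hvw
  have hdisj : Disjoint X (B \ N) := h.disjoint.mono hX Set.sdiff_subset
  have hle : X.ncard + ((B : Set V) \ N).ncard ≤ #B := by
    rw [← Set.ncard_union_eq hdisj]
    lift X ∪ (B \ N) to Finset V using Set.toFinite _ with S
    rw [Set.ncard_coe_finset]
    exact hB.maximum S hindep
  rw [← Set.ncard_coe_finset, ← Set.ncard_sdiff_add_ncard_of_subset hNB] at hle
  omega

lemma exists_isPerfectMatching (h : IsBipartition G A B) (hA : G.IsMaximumIndepSet A)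
    (hB : G.IsMaximumIndepSet B) : ∃ M : G.Subgraph, M.IsPerfectMatching := by
  classical
  have := Fintype.ofFinite V
  obtain ⟨M, hAM, hM⟩ := exists_isMatching_of_forall_ncard_le h.toIsBipartiteWith
    fun X hX => h.ncard_le_ncard_biUnion_neighborSet hB hX
  have hcard : 2 * #A = Nat.card V := by
    have hle := hB.maximum A hA.isIndepSet
    have hge := hA.maximum B hB.isIndepSet
    have hsum := h.card_add_card
    omega
  have hverts := two_mul_ncard_le_ncard_verts hM hA.isIndepSet hAM
  rw [Set.ncard_coe_finset, hcard, ← Set.ncard_univ] at hverts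
  have huniv : M.verts = Set.univ := Set.eq_of_subset_of_ncard_le (Set.subset_univ _) hverts
  exact ⟨M, hM, Subgraph.isSpanning_iff.2 huniv⟩

end IsBipartition

end Matchings

section RobustlyMatchable

variable {V : Type*} {G : SimpleGraph V} {A B : Finset V}

/-- `G` still has a perfect matching after the removal of any one edge. The condition is imposed on
every `e : Sym2 V`, edge of `G` or not, so that it includes the existence of a perfect matching as
soon as `V` is nonempty. -/
def IsRobustlyMatchable (G : SimpleGraph V) : Prop :=
  ∀ e : Sym2 V, ∃ M : G.Subgraph, M.IsPerfectMatching ∧ e ∉ M.edgeSet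

lemma IsRobustlyMatchable.exists_isPerfectMatching [Nonempty V] (h : IsRobustlyMatchable G) :
    ∃ M : G.Subgraph, M.IsPerfectMatching := by
  obtain ⟨v⟩ := ‹Nonempty V›
  exact (h s(v, v)).imp fun _ => And.left

lemma exists_isPerfectMatching_deleteEdges_iff {e : Sym2 V} :
    (∃ M : (G.deleteEdges {e}).Subgraph, M.IsPerfectMatching) ↔
      ∃ M : G.Subgraph, M.IsPerfectMatching ∧ e ∉ M.edgeSet := by
  constructor
  · rintro ⟨M, hM⟩
    refine ⟨G.toSubgraph M.spanningCoe (M.spanningCoe_le.trans (deleteEdges_le _)),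
      (Subgraph.IsPerfectMatching.toSubgraph_iff _).2 hM, fun he => ?_⟩
    induction e with | _ x y
    exact (deleteEdges_adj.1 (M.adj_sub he)).2 rfl
  · rintro ⟨M, hM, he⟩
    refine ⟨(G.deleteEdges {e}).toSubgraph M.spanningCoe fun v w hvw => ?_,
      (Subgraph.IsPerfectMatching.toSubgraph_iff _).2 hM⟩
    refine deleteEdges_adj.2 ⟨hvw.adj_sub, ?_⟩
    rintro rfl
    exact he hvw

section Stability

variable [Finite V]

lemma IsAlphaMinusStable.isRobustlyMatchable (h : IsAlphaMinusStable G)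
    (hAB : IsBipartition G A B) (hA : G.IsMaximumIndepSet A) (hB : G.IsMaximumIndepSet B) :
    IsRobustlyMatchable G := by
  intro e
  by_cases he : e ∈ G.edgeSet
  · have hmax {S : Finset V} (hS : G.IsMaximumIndepSet S) :
        (G.deleteEdges {e}).IsMaximumIndepSet S := by
      rw [isMaximumIndepSet_iff_card_eq] at hS ⊢
      exact ⟨isIndepSet_mono (deleteEdges_le _) hS.1, hS.2.trans (h e he).symm⟩
    exact exists_isPerfectMatching_deleteEdges_iff.1 <|
      (hAB.mono (deleteEdges_le _)).exists_isPerfectMatching (hmax hA) (hmax hB)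
  · obtain ⟨M, hM⟩ := hAB.exists_isPerfectMatching hA hB
    exact ⟨M, hM, fun heM => he (M.edgeSet_subset heM)⟩

lemma IsAlphaStable.isRobustlyMatchable (h : IsAlphaStable G) (hG : G.IsBipartite)
    (hnbr : ∀ v, ∃ w, G.Adj v w) : IsRobustlyMatchable G := by
  obtain ⟨A, B, hAB⟩ := exists_isBipartition hG
  have hcore := h.2.core_subsingleton
  exact h.1.isRobustlyMatchable hAB
    (hAB.symm.isMaximumIndepSet_right_of_subsingleton_core hcore hnbr)
    (hAB.isMaximumIndepSet_right_of_subsingleton_core hcore hnbr)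

lemma IsRobustlyMatchable.isAlphaMinusStable (h : IsRobustlyMatchable G)
    (hAB : IsBipartition G A B) : IsAlphaMinusStable G := by
  intro e _
  obtain ⟨M, hM, heM⟩ := h e
  obtain ⟨N, hN⟩ := exists_isPerfectMatching_deleteEdges_iff.2 ⟨M, hM, heM⟩
  have hcard := hAB.two_mul_indepNum hM
  have hcard_delete := (hAB.mono (deleteEdges_le {e})).two_mul_indepNum hN
  omega

lemma IsBipartition.isAlphaPlusStable (h : IsBipartition G A B) {M : G.Subgraph}
    (hM : M.IsPerfectMatching) : IsAlphaPlusStable G := by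
  intro e _
  induction e with | _ x y
  refine (indepNum_anti le_sup_left).antisymm ?_
  wlog hxy : x ∈ A → y ∉ A generalizing A B
  · push Not at hxy
    exact this h.symm fun hxB => absurd hxy.1 (h.mem_right_iff.1 hxB)
  have hA := h.isMaximumIndepSet_left hM
  rw [← G.maximumIndepSet_card_eq_indepNum A hA]
  exact (isIndepSet_sup_fromEdgeSet h.isIndepSet_left hxy).card_le_indepNum

lemma IsRobustlyMatchable.isAlphaStable [Nonempty V] (h : IsRobustlyMatchable G)
    (hG : G.IsBipartite) : IsAlphaStable G := by
  obtain ⟨A, B, hAB⟩ := exists_isBipartition hG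
  obtain ⟨M, hM⟩ := h.exists_isPerfectMatching
  exact ⟨h.isAlphaMinusStable hAB, hAB.isAlphaPlusStable hM⟩

end Stability

section MatchableEdges

lemma isRobustlyMatchable_iff_iInter_eq_empty [Nonempty V] : IsRobustlyMatchable G ↔
    (∃ M : G.Subgraph, M.IsPerfectMatching) ∧
      (⋂ M ∈ {M : G.Subgraph | M.IsPerfectMatching}, M.edgeSet) = (∅ : Set (Sym2 V)) := by
  refine ⟨fun h => ⟨h.exists_isPerfectMatching, ?_⟩, fun ⟨_, hinter⟩ e => ?_⟩
  · refine Set.eq_empty_of_forall_notMem fun e he => ?_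
    obtain ⟨M, hM, heM⟩ := h e
    exact heM (Set.mem_iInter₂.1 he M hM)
  · have he := Set.eq_empty_iff_forall_notMem.1 hinter e
    simpa only [Set.mem_iInter, Set.mem_ofPred_eq, not_forall, exists_prop] using he

lemma isRobustlyMatchable_iff_two_le_ncard [Finite V] : IsRobustlyMatchable G ↔
    ∀ v : V, 2 ≤ {e : Sym2 V | e ∈ G.incidenceSet v ∧
      ∃ M : G.Subgraph, M.IsPerfectMatching ∧ e ∈ M.edgeSet}.ncard := by
  refine ⟨fun h v => ?_, fun h e => ?_⟩
  · obtain ⟨M, hM, -⟩ := h s(v, v)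
    obtain ⟨x, hx, -⟩ := hM.1 (hM.2 v)
    obtain ⟨N, hN, hxN⟩ := h s(v, x)
    obtain ⟨y, hy, -⟩ := hN.1 (hN.2 v)
    exact (Set.one_lt_ncard (Set.toFinite _)).2
      ⟨s(v, x), ⟨⟨hx.adj_sub, Sym2.mem_mk_left _ _⟩, M, hM, hx⟩,
        s(v, y), ⟨⟨hy.adj_sub, Sym2.mem_mk_left _ _⟩, N, hN, hy⟩, fun heq => hxN (heq ▸ hy)⟩
  · induction e with | _ x y
    obtain ⟨e, ⟨⟨-, hxe⟩, M, hM, heM⟩, hne⟩ := Set.exists_ne_of_one_lt_ncard (h x) s(x, y)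
    obtain ⟨w, rfl⟩ := Sym2.mem_iff_exists.1 hxe
    exact ⟨M, hM, fun hxy => hne (Sym2.congr_right.2 (hM.1.eq_of_adj_left heM hxy))⟩

end MatchableEdges

section AlternatingCycles

variable {v w x : V}

lemma exists_isAlternatingCycle [Finite V] {M N : G.Subgraph} (hM : M.IsPerfectMatching)
    (hN : N.IsPerfectMatching) (hvwM : M.Adj v w) (hvwN : ¬ N.Adj v w) :
    ∃ p : G.Walk v v, IsAlternatingCycle G p := by
  let D := M.spanningCoe ∆ N.spanningCoe
  have hDG : D ≤ G :=
    symmDiff_le (M.spanningCoe_le.trans le_sup_right) (N.spanningCoe_le.trans le_sup_right)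
  have hvwD : D.Adj v w := .inl ⟨hvwM, hvwN⟩
  obtain ⟨p, hp, -⟩ :=
    (hM.symmDiff_isCycles hN).exists_cycle_toSubgraph_verts_eq_connectedComponentSupp
      (c := D.connectedComponentMk v) rfl ⟨w, hvwD⟩
  refine ⟨p.mapLe hDG, hp.mapLe hDG, M, hM,
    (hM.isAlternating_symmDiff_left hN).mono fun a b hab => ?_⟩
  exact ((Walk.adj_toSubgraph_mapLe hDG).1 hab).adj_sub

lemma IsAlternatingCycle.exists_isPerfectMatching_not_adj {u : V} {p : G.Walk u u}
    (h : IsAlternatingCycle G p) (hx : x ∈ p.support) (y : V) :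
    ∃ M : G.Subgraph, M.IsPerfectMatching ∧ ¬ M.Adj x y := by
  obtain ⟨hp, M, hM, halt⟩ := h
  by_cases hMxy : M.Adj x y
  · have hle : M.spanningCoe ∆ p.toSubgraph.spanningCoe ≤ G :=
      symmDiff_le (M.spanningCoe_le.trans le_sup_right)
        (p.toSubgraph.spanningCoe_le.trans le_sup_right)
    have hpxy : p.toSubgraph.Adj x y := by
      obtain ⟨b, c, hbc, hnbr⟩ :=
        Set.ncard_eq_two.1 (hp.ncard_neighborSet_toSubgraph_eq_two hx)
      have hxb : p.toSubgraph.Adj x b := hnbr.symm.subset (.inl rfl)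
      have hxc : p.toSubgraph.Adj x c := hnbr.symm.subset (.inr rfl)
      by_cases hMxb : M.Adj x b
      · exact hM.1.eq_of_adj_left hMxb hMxy ▸ hxb
      · have hMxc : M.Adj x c := not_not.1 fun hnot => hMxb ((halt hbc hxb hxc).2 hnot)
        exact hM.1.eq_of_adj_left hMxc hMxy ▸ hxc
    refine ⟨G.toSubgraph _ hle, (Subgraph.IsPerfectMatching.toSubgraph_iff hle).2
      (hM.symmDiff_of_isAlternating halt hp.isCycles_spanningCoe_toSubgraph), ?_⟩
    rintro (hadj | hadj)
    · exact hadj.2 hpxy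
    · exact hadj.2 hMxy
  · exact ⟨M, hM, hMxy⟩

lemma isRobustlyMatchable_iff_isAlternatingCycle [Finite V] : IsRobustlyMatchable G ↔
    ∀ v : V, ∃ (u : V) (p : G.Walk u u), IsAlternatingCycle G p ∧ v ∈ p.support := by
  refine ⟨fun h v => ?_, fun h e => ?_⟩
  · obtain ⟨M, hM, -⟩ := h s(v, v)
    obtain ⟨w, hvw, -⟩ := hM.1 (hM.2 v)
    obtain ⟨N, hN, hvwN⟩ := h s(v, w)
    obtain ⟨p, hp⟩ := exists_isAlternatingCycle hM hN hvw hvwN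
    exact ⟨v, p, hp, p.start_mem_support⟩
  · induction e with | _ x y
    obtain ⟨u, p, hp, hx⟩ := h x
    exact hp.exists_isPerfectMatching_not_adj hx y

end AlternatingCycles

section BistableParts

lemma IsBistableBipartite.isAlphaMinusStable [Finite V] (h : IsBistableBipartite G)
    (hcard : 4 ≤ Nat.card V) : IsAlphaMinusStable G := by
  classical
  obtain ⟨A, B, hbip, huniv, -, hmax⟩ := h
  have hAB : IsBipartition G A B := ⟨hbip, huniv⟩
  have hcardA := G.maximumIndepSet_card_eq_indepNum A ((hmax A).2 (.inl rfl))
  have hcardB := G.maximumIndepSet_card_eq_indepNum B ((hmax B).2 (.inr rfl))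
  have hsum := hAB.card_add_card
  intro e he
  induction e with | _ x y
  refine le_antisymm ?_ (indepNum_anti (deleteEdges_le _))
  by_contra! hlt
  obtain ⟨S, hS⟩ := (G.deleteEdges {s(x, y)}).exists_isNIndepSet_indepNum
  rw [← hS.card_eq] at hlt
  have hyS : y ∈ S := (mem_of_indepNum_lt_card hS.isIndepSet hlt).2
  obtain ⟨hx, hy⟩ := isMaximumIndepSet_erase_of_deleteEdges hS.isIndepSet hlt
  rw [hmax] at hx hy
  have hne : S.erase x ≠ S.erase y := fun heq =>
    notMem_erase y S (heq ▸ mem_erase.2 ⟨(G.ne_of_adj he).symm, hyS⟩)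
  have hdisj : Disjoint (S.erase x) (S.erase y) := by
    rcases hx with hx | hx <;> rcases hy with hy | hy <;> rw [hx, hy] at hne ⊢
    · exact absurd rfl hne
    · exact hAB.disjoint_finset
    · exact hAB.symm.disjoint_finset
    · exact absurd rfl hne
  have hsub : S ⊆ {x, y} := by
    intro z hz
    by_contra hzxy
    simp only [mem_insert, mem_singleton, not_or] at hzxy
    exact disjoint_left.1 hdisj (mem_erase.2 ⟨hzxy.1, hz⟩) (mem_erase.2 ⟨hzxy.2, hz⟩)
  have hle_two := (card_le_card hsub).trans card_le_two
  omega

lemma IsBistableBipartite.isRobustlyMatchable [Finite V] (h : IsBistableBipartite G)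
    (hcard : 4 ≤ Nat.card V) : IsRobustlyMatchable G := by
  obtain ⟨A, B, hbip, huniv, -, hmax⟩ := id h
  exact (h.isAlphaMinusStable hcard).isRobustlyMatchable ⟨hbip, huniv⟩ ((hmax A).2 (.inl rfl))
    ((hmax B).2 (.inr rfl))

lemma IsRobustlyMatchable.exists_isMatching_verts_eq {s : Set V}
    (h : IsRobustlyMatchable (G.induce s)) (hs : s.Nonempty) (e : Sym2 V) :
    ∃ M : G.Subgraph, M.IsMatching ∧ M.verts = s ∧ e ∉ M.edgeSet := by
  have := hs.to_subtype
  obtain ⟨M, hM, heM⟩ : ∃ M : (G.induce s).Subgraph, M.IsPerfectMatching ∧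
      ∀ e', e'.map Subtype.val = e → e' ∉ M.edgeSet := by
    by_cases he : ∃ e' : Sym2 s, e'.map Subtype.val = e
    · obtain ⟨e', rfl⟩ := he
      obtain ⟨M, hM, heM⟩ := h e'
      exact ⟨M, hM, fun e'' heq => Sym2.map.injective Subtype.val_injective heq ▸ heM⟩
    · obtain ⟨M, hM⟩ := h.exists_isPerfectMatching
      exact ⟨M, hM, fun e' heq => absurd ⟨e', heq⟩ he⟩
  refine ⟨M.map (Embedding.induce s).toHom, hM.1.map _ Subtype.val_injective, ?_, ?_⟩
  · rw [Subgraph.map_verts, hM.2.verts_eq_univ, Set.image_univ]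
    exact Subtype.range_val
  · rw [Subgraph.edgeSet_map]
    rintro ⟨e', he', heq⟩
    exact heM e' heq he'

lemma IsRobustlyMatchable.of_partition {ι : Type*} {U : ι → Set V}
    (hdisj : Pairwise fun i j => Disjoint (U i) (U j)) (hcover : ⋃ i, U i = Set.univ)
    (hne : ∀ i, (U i).Nonempty) (h : ∀ i, IsRobustlyMatchable (G.induce (U i))) :
    IsRobustlyMatchable G := by
  intro e
  choose M hM hverts heM using fun i => (h i).exists_isMatching_verts_eq (hne i) e
  refine ⟨⨆ i, M i, ⟨.iSup hM fun i j hij => ?_, ?_⟩, ?_⟩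
  · simpa only [(hM _).support_eq_verts, hverts] using hdisj hij
  · rw [Subgraph.isSpanning_iff, Subgraph.verts_iSup]
    simp only [hverts, hcover]
  · simpa only [Subgraph.edgeSet_iSup, Set.mem_iUnion, not_exists] using heM

lemma HasBistableDecomposition.isRobustlyMatchable [Finite V] (h : HasBistableDecomposition G) :
    IsRobustlyMatchable G := by
  obtain ⟨k, U, -, hdisj, hcover, hU⟩ := h
  refine .of_partition hdisj hcover (fun i => ?_) fun i => (hU i).1.isRobustlyMatchable (hU i).2
  exact Set.nonempty_of_ncard_ne_zero (by have := (hU i).2; omega)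

end BistableParts

section MatchableGraph

/-- The spanning subgraph of `G` formed by the edges that lie in some perfect matching of `G`. For
bipartite `G` satisfying `IsRobustlyMatchable`, its components span bistable subgraphs. -/
def matchableGraph (G : SimpleGraph V) : SimpleGraph V :=
  ⨆ (M : G.Subgraph) (_ : M.IsPerfectMatching), M.spanningCoe

lemma matchableGraph_adj {v w : V} :
    (matchableGraph G).Adj v w ↔ ∃ M : G.Subgraph, M.IsPerfectMatching ∧ M.Adj v w := by
  simp only [matchableGraph, iSup_adj, Subgraph.spanningCoe_adj, exists_prop]

lemma iff_of_preconnected (hG : G.Preconnected) {P : V → Prop}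
    (hP : ∀ v w, G.Adj v w → (P v ↔ P w)) (v w : V) : P v ↔ P w := by
  obtain ⟨p⟩ := hG v w
  induction p with
  | nil => rfl
  | cons hadj _ ih => exact (hP _ _ hadj).trans ih

-- Membership in `S` and membership in `A` both alternate along the edges of `matchableGraph G`, so
-- they agree everywhere or nowhere.
lemma IsBipartition.eq_or_eq_of_isMaximumIndepSet [Finite V] (h : IsBipartition G A B)
    (hconn : (matchableGraph G).Preconnected) {S : Finset V} (hS : G.IsMaximumIndepSet S)
    {M : G.Subgraph} (hM : M.IsPerfectMatching) : S = A ∨ S = B := by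
  rw [h.isMaximumIndepSet_iff hM] at hS
  have hagree : ∀ v w, (matchableGraph G).Adj v w → ((v ∈ S ↔ v ∈ A) ↔ (w ∈ S ↔ w ∈ A)) := by
    intro v w hvw
    obtain ⟨N, hN, hvwN⟩ := matchableGraph_adj.1 hvw
    have hA : v ∈ A ↔ w ∉ A := h.mem_left_iff_of_adj hvwN.adj_sub
    have hS : v ∈ S ↔ w ∉ S :=
      mem_iff_notMem_of_two_mul_ncard_eq hN.1 hS.1 (by simp [hN.2.verts_eq_univ])
        (by simpa [hN.2.verts_eq_univ] using hS.2) hvwN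
    tauto
  by_cases hall : ∀ v, v ∈ S ↔ v ∈ A
  · exact .inl (Finset.ext hall)
  · obtain ⟨a, ha⟩ := not_forall.1 hall
    refine .inr (Finset.ext fun v => ?_)
    have hv : ¬ (v ∈ S ↔ v ∈ A) := fun hv => ha ((iff_of_preconnected hconn hagree a v).2 hv)
    rw [h.mem_right_iff]
    tauto

lemma isBistableBipartite_of_connected_matchableGraph [Finite V] (hG : G.IsBipartite)
    (hconn : (matchableGraph G).Connected) {M : G.Subgraph} (hM : M.IsPerfectMatching) :
    IsBistableBipartite G := by
  obtain ⟨A, B, h⟩ := exists_isBipartition hG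
  obtain ⟨a⟩ := hconn.nonempty
  refine ⟨A, B, h.toIsBipartiteWith, h.union_eq_univ, fun heq => ?_,
    fun S => ⟨fun hS => h.eq_or_eq_of_isMaximumIndepSet hconn.preconnected hS hM, ?_⟩⟩
  · have ha : a ∈ B ↔ a ∉ A := h.mem_right_iff
    exact iff_not_self (heq ▸ ha)
  · rintro (rfl | rfl)
    · exact h.isMaximumIndepSet_left hM
    · exact h.symm.isMaximumIndepSet_left hM

lemma isPerfectMatching_comap_induce {M : G.Subgraph} (hM : M.IsPerfectMatching) {s : Set V}
    (hs : ∀ v ∈ s, ∀ w, M.Adj v w → w ∈ s) :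
    (M.comap (Embedding.induce s).toHom).IsPerfectMatching := by
  rw [Subgraph.isPerfectMatching_iff]
  rintro ⟨v, hv⟩
  obtain ⟨w, hvw, -⟩ := hM.1 (hM.2 v)
  exact ⟨⟨w, hs v hv w hvw⟩, ⟨hvw.adj_sub, hvw⟩,
    fun u hu => Subtype.ext (hM.1.eq_of_adj_left hu.2 hvw)⟩

lemma isPerfectMatching_comap_induce_supp {M : G.Subgraph} (hM : M.IsPerfectMatching)
    (c : (matchableGraph G).ConnectedComponent) :
    (M.comap (Embedding.induce c.supp).toHom).IsPerfectMatching :=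
  isPerfectMatching_comap_induce hM fun _ hv _ hvw =>
    (c.mem_supp_congr_adj (matchableGraph_adj.2 ⟨M, hM, hvw⟩)).1 hv

lemma connected_matchableGraph_induce_supp (c : (matchableGraph G).ConnectedComponent) :
    (matchableGraph (G.induce c.supp)).Connected := by
  refine c.connected_toSimpleGraph.mono fun v w hvw => ?_
  obtain ⟨M, hM, hvwM⟩ := matchableGraph_adj.1 hvw
  exact matchableGraph_adj.2
    ⟨_, isPerfectMatching_comap_induce_supp hM c, hvwM.adj_sub, hvwM⟩

lemma IsRobustlyMatchable.induce_supp (h : IsRobustlyMatchable G)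
    (c : (matchableGraph G).ConnectedComponent) : IsRobustlyMatchable (G.induce c.supp) := by
  intro e
  obtain ⟨M, hM, heM⟩ := h (e.map Subtype.val)
  refine ⟨_, isPerfectMatching_comap_induce_supp hM c, fun he => heM ?_⟩
  induction e with | _ v w
  exact he.2

lemma IsRobustlyMatchable.four_le_card [Finite V] [Nonempty V] (h : IsRobustlyMatchable G) :
    4 ≤ Nat.card V := by
  classical
  have := Fintype.ofFinite V
  obtain ⟨v⟩ := ‹Nonempty V›
  obtain ⟨M, hM, -⟩ := h s(v, v)
  obtain ⟨x, hvx, -⟩ := hM.1 (hM.2 v)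
  obtain ⟨N, hN, hvxN⟩ := h s(v, x)
  obtain ⟨y, hvy, -⟩ := hN.1 (hN.2 v)
  have hxy : x ≠ y := fun heq => hvxN (heq ▸ hvy)
  have hthree : 3 ≤ Fintype.card V := by
    rw [← card_eq_three.2 ⟨v, x, y, hvx.ne, hvy.ne, hxy, rfl⟩]
    exact card_le_univ _
  obtain ⟨n, hn⟩ := hM.even_card
  rw [Nat.card_eq_fintype_card]
  omega

lemma IsRobustlyMatchable.hasBistableDecomposition [Finite V] [Nonempty V]
    (h : IsRobustlyMatchable G) (hG : G.IsBipartite) : HasBistableDecomposition G := by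
  let index := Finite.equivFin (matchableGraph G).ConnectedComponent
  refine ⟨_, fun i => (index.symm i).supp, Nat.card_pos, fun i j hij => ?_, ?_, fun i => ?_⟩
  · exact pairwise_disjoint_supp_connectedComponent _ (index.symm.injective.ne hij)
  · rw [index.symm.surjective.iUnion_comp fun c => c.supp]
    exact iUnion_connectedComponentSupp _
  · have := (index.symm i).nonempty_supp.to_subtype
    have hi := h.induce_supp (index.symm i)
    obtain ⟨M, hM⟩ := hi.exists_isPerfectMatching
    exact ⟨isBistableBipartite_of_connected_matchableGraph (hG.of_hom (Embedding.induce _).toHom)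
      (connected_matchableGraph_induce_supp _) hM, hi.four_le_card⟩

end MatchableGraph

end RobustlyMatchable

end AlphaStable

open AlphaStable in
theorem theorem5p6_general {V : Type*} [Finite V] [Nonempty V] (G : SimpleGraph V)
    (hnbr : ∀ v, ∃ w, G.Adj v w) (hbip : G.IsBipartite) :
    List.TFAE [
      IsAlphaStable G,
      HasBistableDecomposition G,
      (∃ M : G.Subgraph, M.IsPerfectMatching) ∧
        (⋂ M ∈ {M : G.Subgraph | M.IsPerfectMatching}, M.edgeSet) = (∅ : Set (Sym2 V)),
      ∀ v : V, 2 ≤ {e : Sym2 V | e ∈ G.incidenceSet v ∧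
        ∃ M : G.Subgraph, M.IsPerfectMatching ∧ e ∈ M.edgeSet}.ncard,
      ∀ v : V, ∃ (u : V) (p : G.Walk u u), IsAlternatingCycle G p ∧ v ∈ p.support] := by
  rw [← isRobustlyMatchable_iff_iInter_eq_empty, ← isRobustlyMatchable_iff_two_le_ncard,
    ← isRobustlyMatchable_iff_isAlternatingCycle]
  tfae_have 1 → 3 := fun h => h.isRobustlyMatchable hbip hnbr
  tfae_have 3 → 1 := fun h => h.isAlphaStable hbip
  tfae_have 2 → 3 := fun h => h.isRobustlyMatchable
  tfae_have 3 → 2 := fun h => h.hasBistableDecomposition hbip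
  tfae_have 3 ↔ 4 := Iff.rfl
  tfae_have 4 ↔ 5 := Iff.rfl
  tfae_finish

theorem theorem5p6 {V : Type*} [Finite V] [Nontrivial V] (G : SimpleGraph V)
    (hconn : G.Connected) (hbip : G.IsBipartite) :
    List.TFAE [
      AlphaStable.IsAlphaStable G,
      AlphaStable.HasBistableDecomposition G,
      (∃ M : G.Subgraph, M.IsPerfectMatching) ∧
        (⋂ M ∈ {M : G.Subgraph | M.IsPerfectMatching}, M.edgeSet) = (∅ : Set (Sym2 V)),
      ∀ v : V, 2 ≤ {e : Sym2 V | e ∈ G.incidenceSet v ∧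
        ∃ M : G.Subgraph, M.IsPerfectMatching ∧ e ∈ M.edgeSet}.ncard,
      ∀ v : V, ∃ (u : V) (p : G.Walk u u),
        AlphaStable.IsAlternatingCycle G p ∧ v ∈ p.support] :=
  theorem5p6_general G hconn.preconnected.exists_adj_of_nontrivial hbip
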